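/- Let $\Sigma$ be a finite alphabet and let $\#\notin\Sigma$ be a separator symbol. A subword embedding $f\colon u\to v$ between words is a strictly increasing map from the positions of $u$ to the positions of $v$ with $u_i=v_{f(i)}$ for all $i$; with $k=|u|$, it determines gap words $G_{f,0},\dots,G_{f,k}$, where $v=G_{f,0}\,u_1\,G_{f,1}\,u_2\cdots u_k\,G_{f,k}$ and $u_i$ stands at position $f(i)$ of $v$. An amalgamation system over $\Sigma$ consists of a set $R$ of runs, a map $\mathrm{can}\colon R\to(\Sigma\cup\{\#\})^*$ and, for all $\rho,\sigma\in R$, a set $E(\rho,\sigma)$ of subword embeddings from $\mathrm{can}(\rho)$ to $\mathrm{can}(\sigma)$, such that: 1. $\mathrm{id}\in E(\rho,\rho)$ for every $\rho\in R$, and $g\circ f\in E(\rho,\tau)$ whenever $f\in E(\rho,\sigma)$ and $g\in E(\sigma,\tau)$. 2. The relation $\rho\trianglelefteq\sigma :\iff E(\rho,\sigma)\neq\emptyset$ is a well-quasi-order on $R$. 3. For all $f\in E(\rho_0,\rho_1)$, $g\in E(\rho_0,\rho_2)$ and $0\le i\le|\mathrm{can}(\rho_0)|$ there are $\rho_3\in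 R$, $g'\in E(\rho_1,\rho_3)$ and $f'\in E(\rho_2,\rho_3)$ such that $g'\circ f=f'\circ g=:h$, $G_{h,j}\in\{G_{f,j}G_{g,j},\,G_{g,j}G_{f,j}\}$ for every $0\le j\le|\mathrm{can}(\rho_0)|$, and $G_{h,i}=G_{f,i}G_{g,i}$. The language recognized by the system is the set of all words obtained from the words $\mathrm{can}(\rho)$, $\rho\in R$, by erasing every occurrence of $\#$. **Theorem.** Let $L\subseteq\Sigma^*$ be a language recognized by an amalgamation system. If $L$ is well-quasi-ordered by the infix relation (that is, every infinite sequence $x_0,x_1,\dots$ of words of $L$ has indices $m<n$ such that $x_n=y\,x_m\,z$ for some words $y,z$), then $L$ is bounded, i.e. there are finitely many words $w_1,\dots,w_n\in\Sigma^*$ with $L\subseteq w_1^*\cdots w_n^*$. -/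

import Mathlib

/-- A subword embedding of the word `u` into the word `v`: a strictly increasing map from the
positions of `u` to the positions of `v` that preserves letters. -/
@[ext]
structure SubwordEmbedding {β : Type*} (u v : List β) where
  toFun : Fin u.length → Fin v.length
  strictMono : StrictMono toFun
  get_eq : ∀ i, u.get i = v.get (toFun i)

namespace SubwordEmbedding

variable {β : Type*} {u v w : List β}

/-- The identity embedding. -/
protected def id (u : List β) : SubwordEmbedding u u where
  toFun i := i
  strictMono := strictMono_id
  get_eq _ := rfl

/-- The composition `g ∘ f` of subword embeddings. -/
def comp (g : SubwordEmbedding v w) (f : SubwordEmbedding u v) : SubwordEmbedding u w where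
  toFun i := g.toFun (f.toFun i)
  strictMono := g.strictMono.comp f.strictMono
  get_eq i := (f.get_eq i).trans (g.get_eq _)

/-- The position of `v` at which the `j`-th gap of `f` starts: the beginning of `v` if `j = 0`,
and just after the image of the `j`-th letter of `u` otherwise. -/
def gapStart (f : SubwordEmbedding u v) (j : Fin (u.length + 1)) : ℕ :=
  Fin.cases (motive := fun _ => ℕ) 0 (fun i => (f.toFun i : ℕ) + 1) j

/-- The position of `v` just after the end of the `j`-th gap of `f`: the end of `v` if `j = |u|`,
and the position of the image of the `(j+1)`-st letter of `u` otherwise. -/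
def gapStop (f : SubwordEmbedding u v) (j : Fin (u.length + 1)) : ℕ :=
  Fin.lastCases (motive := fun _ => ℕ) v.length (fun i => (f.toFun i : ℕ)) j

/-- The `j`-th gap word of `f`, for `0 ≤ j ≤ |u|`, so that
`v = (gapWord 0) u₁ (gapWord 1) u₂ ⋯ uₖ (gapWord k)` where `k = |u|`. -/
def gapWord (f : SubwordEmbedding u v) (j : Fin (u.length + 1)) : List β :=
  (v.take (f.gapStop j)).drop (f.gapStart j)

end SubwordEmbedding

/-- An amalgamation system over the alphabet `α`. The alphabet extended with a fresh separator
symbol is `Option α`, the separator being `none`. -/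
structure AmalgamationSystem.{u, v} (α : Type u) where
  /-- The set of runs. -/
  Run : Type v
  /-- The canonical decomposition of a run. -/
  can : Run → List (Option α)
  /-- The admissible embeddings between runs. -/
  E : (ρ σ : Run) → Set (SubwordEmbedding (can ρ) (can σ))
  /-- Identities are admissible. -/
  id_mem : ∀ ρ, SubwordEmbedding.id (can ρ) ∈ E ρ ρ
  /-- Admissible embeddings compose. -/
  comp_mem : ∀ {ρ σ τ : Run}, ∀ f ∈ E ρ σ, ∀ g ∈ E σ τ, g.comp f ∈ E ρ τ
  /-- The relation "there is an admissible embedding from `ρ` to `σ`" well-quasi-orders runs. -/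
  wqo : WellQuasiOrdered fun ρ σ : Run => (E ρ σ).Nonempty
  /-- Concatenative amalgamation. -/
  amalgamation : ∀ {ρ₀ ρ₁ ρ₂ : Run}, ∀ f ∈ E ρ₀ ρ₁, ∀ g ∈ E ρ₀ ρ₂,
    ∀ i : Fin ((can ρ₀).length + 1),
      ∃ ρ₃ : Run, ∃ g' ∈ E ρ₁ ρ₃, ∃ f' ∈ E ρ₂ ρ₃,
        g'.comp f = f'.comp g ∧
        (∀ j : Fin ((can ρ₀).length + 1),
          (g'.comp f).gapWord j = f.gapWord j ++ g.gapWord j ∨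
          (g'.comp f).gapWord j = g.gapWord j ++ f.gapWord j) ∧
        (g'.comp f).gapWord i = f.gapWord i ++ g.gapWord i

namespace AmalgamationSystem

variable {α : Type*}

/-- The yield of a run: its canonical decomposition with all separators erased. -/
def yield (A : AmalgamationSystem α) (ρ : A.Run) : List α :=
  (A.can ρ).reduceOption

/-- `A` recognizes `L` if `L` is the set of all yields of runs of `A`. -/
def Recognizes (A : AmalgamationSystem α) (L : Language α) : Prop :=
  L = Set.range A.yield

end AmalgamationSystem

/-- `L` is well-quasi-ordered by the infix relation: every infinite sequence `x₀, x₁, …` of words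
of `L` has indices `m < n` such that `xₘ` is an infix of `xₙ`. -/
def InfixWellQuasiOrdered {α : Type*} (L : Language α) : Prop :=
  WellQuasiOrdered fun u v : {w : List α // w ∈ L} => (u : List α) <:+: (v : List α)

/-- `L` is a bounded language: `L ⊆ w₁* w₂* ⋯ wₙ*` for some finite list of words `w₁, …, wₙ`. -/
def IsBoundedLanguage {α : Type*} (L : Language α) : Prop :=
  ∃ ws : List (List α), L ≤ (ws.map fun w => KStar.kstar ({w} : Language α)).prod

/-- The number of positions at which a word differs from its shift by `q + 1`. -/
noncomputable def shiftMismatches {α : Type*} (q : ℕ) : List α → ℕ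
  | [] => 0
  | a :: w =>
    haveI := Classical.propDecidable (∃ b, w[q]? = some b ∧ b ≠ a)
    shiftMismatches q w + if ∃ b, w[q]? = some b ∧ b ≠ a then 1 else 0

section ShiftMismatches

variable {α : Type*} {q : ℕ}

theorem shiftMismatches_cons_le (a : α) (w : List α) :
    shiftMismatches q (a :: w) ≤ shiftMismatches q w + 1 := by
  simp only [shiftMismatches]
  split_ifs <;> omega

theorem shiftMismatches_append_le_min (x y : List α) :
    shiftMismatches q (x ++ y) ≤
      shiftMismatches q x + shiftMismatches q y + min x.length (q + 1) := by
  induction x with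
  | nil => simp [shiftMismatches]
  | cons a x ih =>
    simp only [List.cons_append, shiftMismatches, List.length_cons]
    by_cases h : q < x.length
    · rw [List.getElem?_append_left h]
      omega
    · split_ifs <;> omega

theorem shiftMismatches_append_le (x y : List α) :
    shiftMismatches q (x ++ y) ≤ shiftMismatches q x + shiftMismatches q y + (q + 1) :=
  (shiftMismatches_append_le_min x y).trans (by omega)

theorem le_shiftMismatches_append (x y : List α) :
    shiftMismatches q x + shiftMismatches q y ≤ shiftMismatches q (x ++ y) := by
  induction x with
  | nil => simp [shiftMismatches]
  | cons a x ih =>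
    simp only [List.cons_append, shiftMismatches]
    split_ifs with h₁ h₂
    · omega
    · obtain ⟨b, hb, hne⟩ := h₁
      obtain ⟨hq, -⟩ := List.getElem?_eq_some_iff.1 hb
      exact absurd ⟨b, by rw [List.getElem?_append_left hq, hb], hne⟩ h₂
    · omega
    · omega

theorem shiftMismatches_mono {x y : List α} (h : x <:+: y) :
    shiftMismatches q x ≤ shiftMismatches q y := by
  obtain ⟨s, t, rfl⟩ := h
  have h₁ := le_shiftMismatches_append (q := q) (s ++ x) t
  have h₂ := le_shiftMismatches_append (q := q) s x
  omega

theorem shiftMismatches_eq_zero_iff {w : List α} :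
    shiftMismatches q w = 0 ↔ ∀ t b, w[t + (q + 1)]? = some b → w[t]? = some b := by
  induction w with
  | nil => simp [shiftMismatches]
  | cons a w ih =>
    simp only [shiftMismatches, Nat.add_eq_zero_iff, ih]
    constructor
    · rintro ⟨h₁, h₂⟩ t b hb
      have hb' : w[t + q]? = some b := by simpa [← add_assoc] using hb
      cases t with
      | zero =>
        by_contra hne
        rw [if_pos ⟨b, by simpa using hb', fun h => hne (by simp [h])⟩] at h₂
        simp at h₂
      | succ t =>
        simpa using h₁ t b (by rw [← hb']; congr 1; omega)
    · intro h
      refine ⟨fun t b hb => by simpa using h (t + 1) b (by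
        rw [← hb, show t + 1 + (q + 1) = t + (q + 1) + 1 by omega]; simp), ?_⟩
      rw [if_neg]
      rintro ⟨b, hb, hne⟩
      have := h 0 b (by simpa using hb)
      simp at this
      exact hne this.symm

/-- The `n`-fold power of a word. -/
def wordPow (n : ℕ) (s : List α) : List α := (List.replicate n s).flatten

@[simp] theorem wordPow_zero (s : List α) : wordPow 0 s = [] := rfl

theorem wordPow_succ (n : ℕ) (s : List α) : wordPow (n + 1) s = s ++ wordPow n s := by
  simp [wordPow, List.replicate_succ]

theorem wordPow_add (m n : ℕ) (s : List α) : wordPow (m + n) s = wordPow m s ++ wordPow n s := by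
  rw [wordPow, ← List.replicate_append_replicate, List.flatten_append, wordPow, wordPow]

theorem wordPow_succ' (n : ℕ) (s : List α) : wordPow (n + 1) s = wordPow n s ++ s := by
  rw [wordPow_add]; simp [wordPow]

@[simp] theorem length_wordPow (n : ℕ) (s : List α) : (wordPow n s).length = n * s.length := by
  simp [wordPow]

theorem getElem?_wordPow_add_length {n t : ℕ} {s : List α} {b : α}
    (h : (wordPow n s)[t + s.length]? = some b) : (wordPow n s)[t]? = some b := by
  cases n with
  | zero => simp at h
  | succ n =>
    rw [wordPow_succ, List.getElem?_append_right (by omega), Nat.add_sub_cancel] at h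
    obtain ⟨ht, -⟩ := List.getElem?_eq_some_iff.1 h
    rw [wordPow_succ', List.getElem?_append_left ht, h]

theorem shiftMismatches_wordPow {n : ℕ} {s : List α} (hs : s.length ∣ q + 1) :
    shiftMismatches q (wordPow n s) = 0 := by
  rw [shiftMismatches_eq_zero_iff]
  obtain ⟨r, hr⟩ := hs
  rw [hr]
  clear hr
  induction r with
  | zero => simp
  | succ r ih =>
    intro t b h
    rw [Nat.mul_succ, ← add_assoc] at h
    exact ih t b (getElem?_wordPow_add_length h)

theorem one_le_shiftMismatches_append {x y : List α} (hx : x.length = q + 1)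
    (hy : y.length = q + 1) (hne : x ≠ y) : 1 ≤ shiftMismatches q (x ++ y) := by
  rw [Nat.one_le_iff_ne_zero]
  intro h
  rw [shiftMismatches_eq_zero_iff] at h
  apply hne
  apply List.ext_getElem (by omega)
  intro t h₁ h₂
  have := h t y[t] (by
    rw [List.getElem?_append_right (by omega), hx, Nat.add_sub_cancel]
    exact List.getElem?_eq_getElem h₂)
  rw [List.getElem?_append_left h₁, List.getElem?_eq_getElem h₁] at this
  exact Option.some.inj this

theorem le_shiftMismatches_wordPow (B : ℕ) (x : List α) (hx : 1 ≤ shiftMismatches q x) :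
    B ≤ shiftMismatches q (wordPow B x) := by
  induction B with
  | zero => simp
  | succ B ih =>
    rw [wordPow_succ']
    have := le_shiftMismatches_append (q := q) (wordPow B x) x
    omega

theorem one_le_shiftMismatches_wordPow_append {u v : List α} {n : ℕ} (hlen : u.length = v.length)
    (hne : u ≠ v) (hdvd : u.length ∣ q + 1) (hn : q + 1 ≤ n) :
    1 ≤ shiftMismatches q (wordPow n u ++ wordPow n v) := by
  obtain ⟨r, hr⟩ := hdvd
  have hr0 : r ≠ 0 := by rintro rfl; simp at hr
  have hu0 : u.length ≠ 0 := by intro h; simp [h] at hr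
  have hrn : r ≤ n := by
    have : r ≤ u.length * r := Nat.le_mul_of_pos_left r (by omega)
    omega
  obtain ⟨d, rfl⟩ := Nat.exists_eq_add_of_le hrn
  have h₁ : 1 ≤ shiftMismatches q (wordPow r u ++ wordPow r v) := by
    apply one_le_shiftMismatches_append
    · rw [length_wordPow, hr, mul_comm]
    · rw [length_wordPow, hr, ← hlen, mul_comm]
    · intro h
      obtain ⟨r, rfl⟩ := Nat.exists_eq_succ_of_ne_zero hr0
      rw [Nat.succ_eq_add_one, wordPow_succ, wordPow_succ] at h
      exact hne (List.append_inj_left h hlen)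
  refine h₁.trans (shiftMismatches_mono ⟨wordPow d u, wordPow d v, ?_⟩)
  rw [add_comm r d, wordPow_add, add_comm d r, wordPow_add]
  simp only [List.append_assoc]

end ShiftMismatches

section LocallyPeriodic

variable {α : Type*} {q n k : ℕ}

/-- Short infixes of `w` have few mismatches with their shift by `q + 1`, and short prefixes of `w`
have even fewer. -/
def LocallyPeriodic (q n k : ℕ) (w : List α) : Prop :=
  (∀ x, x <+: w → x.length ≤ n → shiftMismatches q x ≤ k) ∧
    ∀ x, x <:+: w → x.length ≤ n → shiftMismatches q x ≤ k + (q + 1)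

theorem locallyPeriodic_nil : LocallyPeriodic q n k ([] : List α) := by
  constructor <;> intro x hx _ <;> simp at hx <;> simp [hx, shiftMismatches]

theorem LocallyPeriodic.cons {w : List α} (h : LocallyPeriodic q n k w) (a : α) :
    LocallyPeriodic q n (k + 1) (a :: w) := by
  have key : ∀ x, x <+: a :: w → x.length ≤ n → shiftMismatches q x ≤ k + 1 := by
    intro x hx hn
    rcases List.prefix_cons_iff.1 hx with rfl | ⟨t, rfl, ht⟩
    · simp [shiftMismatches]
    · simp only [List.length_cons] at hn
      have h₁ := h.1 t ht (by omega)
      have h₂ := shiftMismatches_cons_le (q := q) a t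
      omega
  refine ⟨key, fun x hx hn => ?_⟩
  rcases List.infix_cons_iff.1 hx with hx | hx
  · have := key x hx hn
    omega
  · have := h.2 x hx hn
    omega

theorem infix_append_cases {x s w : List α} (h : x <:+: s ++ w) :
    x <:+: s ∨ x <:+: w ∨ ∃ y z, x = y ++ z ∧ y <:+ s ∧ z <+: w := by
  induction s with
  | nil => exact Or.inr (Or.inl h)
  | cons a s ih =>
    rcases List.infix_cons_iff.1 h with h | h
    · rcases List.prefix_or_prefix_of_prefix h (List.prefix_append (a :: s) w) with h' | ⟨z, rfl⟩
      · exact Or.inl h'.isInfix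
      · exact Or.inr (Or.inr ⟨a :: s, z, rfl, List.suffix_rfl,
          (List.prefix_append_right_inj _).1 h⟩)
    · rcases ih h with h | h | ⟨y, z, rfl, hy, hz⟩
      · exact Or.inl (List.infix_cons h)
      · exact Or.inr (Or.inl h)
      · exact Or.inr (Or.inr ⟨y, z, rfl, hy.trans (List.suffix_cons a s), hz⟩)

theorem LocallyPeriodic.wordPow_append {w s : List α} (h : LocallyPeriodic q n k w)
    (hs : s = [] ∨ s.length ∣ q + 1) : LocallyPeriodic q n k (wordPow n s ++ w) := by
  rcases hs with rfl | hs
  · simpa [wordPow] using h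
  have h0 : ∀ x, x <:+: wordPow n s → shiftMismatches q x = 0 := fun x hx =>
    Nat.le_zero.1 ((shiftMismatches_mono hx).trans_eq (shiftMismatches_wordPow hs))
  have hpos : 0 < s.length := Nat.pos_of_dvd_of_pos hs (by omega)
  refine ⟨fun x hx hn => ?_, fun x hx hn => ?_⟩
  · have : x <+: wordPow n s := by
      apply List.prefix_of_prefix_length_le hx (List.prefix_append _ _)
      rw [length_wordPow]
      exact hn.trans (Nat.le_mul_of_pos_right n hpos)
    simp [h0 x this.isInfix]
  · rcases infix_append_cases hx with hx | hx | ⟨y, z, rfl, hy, hz⟩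
    · simp [h0 x hx]
    · exact h.2 x hx hn
    · have h₁ := shiftMismatches_append_le (q := q) y z
      have h₂ := h.1 z hz (by simp at hn; omega)
      have h₃ := h0 y hy.isInfix
      omega

theorem LocallyPeriodic.flatten_append {w : List α} (h : LocallyPeriodic q n k w)
    (l : List (List α))
    (hl : ∀ p ∈ l, ∃ s, p = wordPow n s ∧ (s = [] ∨ s.length ∣ q + 1)) :
    LocallyPeriodic q n k (l.flatten ++ w) := by
  induction l with
  | nil => simpa using h
  | cons p l ih =>
    obtain ⟨s, rfl, hs⟩ := hl p (by simp)
    rw [List.flatten_cons, List.append_assoc]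
    exact (ih fun p hp => hl p (by simp [hp])).wordPow_append hs

end LocallyPeriodic

section Fill

variable {α : Type*}

/-- The word obtained from `c` by erasing separators and inserting `G j` in the `j`-th gap. -/
def fillGaps : List (Option α) → (ℕ → List α) → List α
  | [], G => G 0
  | o :: c, G => G 0 ++ (o.toList ++ fillGaps c fun j => G (j + 1))

theorem locallyPeriodic_fillGaps {q n : ℕ} (c : List (Option α)) (G : ℕ → List α)
    (hG : ∀ j, ∃ l : List (List α), G j = l.flatten ∧
      ∀ p ∈ l, ∃ s, p = wordPow n s ∧ (s = [] ∨ s.length ∣ q + 1)) :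
    LocallyPeriodic q n c.length (fillGaps c G) := by
  induction c generalizing G with
  | nil =>
    obtain ⟨l, h, hl⟩ := hG 0
    simpa [fillGaps, h] using (locallyPeriodic_nil (k := 0)).flatten_append l hl
  | cons o c ih =>
    obtain ⟨l, h, hl⟩ := hG 0
    rw [fillGaps, h]
    apply LocallyPeriodic.flatten_append _ l hl
    have ih := ih (fun j => G (j + 1)) fun j => hG (j + 1)
    cases o with
    | none =>
      refine ⟨fun x hx hn => (ih.1 x hx hn).trans (by simp), fun x hx hn => ?_⟩
      have := ih.2 x hx hn
      simp only [List.length_cons]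
      omega
    | some a => exact ih.cons a

theorem infix_fillGaps (c : List (Option α)) (G : ℕ → List α) (j : ℕ) (hj : j ≤ c.length) :
    G j <:+: fillGaps c G := by
  induction c generalizing G j with
  | nil =>
    obtain rfl : j = 0 := by simpa using hj
    exact List.infix_rfl
  | cons o c ih =>
    rw [fillGaps]
    cases j with
    | zero => exact (List.prefix_append _ _).isInfix
    | succ j =>
      refine (ih (fun j => G (j + 1)) j (by simpa using hj)).trans ?_
      exact ((List.suffix_append _ _).trans (List.suffix_append _ _)).isInfix

theorem fillGaps_mem_prod (c : List (Option α)) (W : ℕ → List α) :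
    ∃ ws : List (List α), ∀ G : ℕ → List α, (∀ j ≤ c.length, ∃ n, G j = wordPow n (W j)) →
      fillGaps c G ∈ (ws.map fun w => KStar.kstar ({w} : Language α)).prod := by
  have hpow : ∀ n (w : List α), wordPow n w ∈ KStar.kstar ({w} : Language α) := fun n w =>
    Language.mem_kstar.2 ⟨List.replicate n w, rfl, fun y hy => List.eq_of_mem_replicate hy⟩
  induction c generalizing W with
  | nil =>
    refine ⟨[W 0], fun G hG => ?_⟩
    obtain ⟨n, hn⟩ := hG 0 le_rfl
    simpa [fillGaps, hn] using hpow n (W 0)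
  | cons o c ih =>
    obtain ⟨ws, hws⟩ := ih fun j => W (j + 1)
    refine ⟨W 0 :: o.toList :: ws, fun G hG => ?_⟩
    obtain ⟨n, hn⟩ := hG 0 (Nat.zero_le _)
    rw [List.map_cons, List.prod_cons, List.map_cons, List.prod_cons, fillGaps, hn]
    refine Language.append_mem_mul (hpow n _) (Language.append_mem_mul ?_ ?_)
    · simpa [wordPow] using hpow 1 o.toList
    · exact hws _ fun j hj => hG (j + 1) (by simpa using hj)

end Fill

theorem drop_eq_drop_take_append_drop {α : Type*} (l : List α) {a b : ℕ} (hab : a ≤ b)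
    (hb : b ≤ l.length) : l.drop a = (l.take b).drop a ++ l.drop b := by
  conv_lhs => rw [← List.take_append_drop b l]
  rw [List.drop_append_of_le_length]
  rw [List.length_take]
  omega

namespace SubwordEmbedding

variable {α : Type*} {u v : List (Option α)}

/-- The gap words of an embedding with the separators erased, indexed by the natural numbers. -/
def erasedGap (f : SubwordEmbedding u v) (j : ℕ) : List α :=
  if h : j < u.length + 1 then (f.gapWord ⟨j, h⟩).reduceOption else []

theorem length_erasedGap_le (f : SubwordEmbedding u v) (j : ℕ) :
    (f.erasedGap j).length ≤ v.length := by
  unfold erasedGap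
  split_ifs with h
  · refine (List.reduceOption_length_le _).trans ?_
    simp only [gapWord, List.length_drop, List.length_take]
    omega
  · simp

theorem reduceOption_drop_gapStart (f : SubwordEmbedding u v) (d j : ℕ) (h : j + d = u.length) :
    (v.drop (f.gapStart ⟨j, by omega⟩)).reduceOption =
      fillGaps (u.drop j) fun t => f.erasedGap (j + t) := by
  induction d generalizing j with
  | zero =>
    obtain rfl : j = u.length := by omega
    have hs : f.gapStop ⟨u.length, by omega⟩ = v.length :=
      Fin.lastCases_last (motive := fun _ => ℕ)
    simp [fillGaps, erasedGap, gapWord, hs]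
  | succ d ih =>
    have hj : j < u.length := by omega
    have hs : f.gapStop ⟨j, by omega⟩ = f.toFun ⟨j, hj⟩ :=
      Fin.lastCases_castSucc (motive := fun _ => ℕ) (i := ⟨j, hj⟩)
    have hs' : f.gapStart ⟨j + 1, by omega⟩ = (f.toFun ⟨j, hj⟩ : ℕ) + 1 := rfl
    have hle : f.gapStart ⟨j, by omega⟩ ≤ f.toFun ⟨j, hj⟩ := by
      cases j with
      | zero => exact Nat.zero_le _
      | succ j => exact f.strictMono (a := ⟨j, by omega⟩) (b := ⟨j + 1, hj⟩) (by simp)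
    have ih := ih (j + 1) (by omega)
    rw [hs'] at ih
    rw [List.drop_eq_getElem_cons hj, fillGaps]
    have hG : f.erasedGap (j + 0) = (f.gapWord ⟨j, by omega⟩).reduceOption :=
      dif_pos (show j < u.length + 1 by omega)
    have hget : v[(f.toFun ⟨j, hj⟩ : ℕ)] = u[j] := (f.get_eq ⟨j, hj⟩).symm
    have hv : v.drop (f.gapStart ⟨j, by omega⟩) =
        f.gapWord ⟨j, by omega⟩ ++ u[j] :: v.drop ((f.toFun ⟨j, hj⟩ : ℕ) + 1) := by
      rw [gapWord, hs, ← hget, ← List.drop_eq_getElem_cons]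
      exact drop_eq_drop_take_append_drop v hle (f.toFun ⟨j, hj⟩).2.le
    rw [hv, hG, List.reduceOption_append]
    congr 1
    rw [show (fun t => f.erasedGap (j + (t + 1))) = fun t => f.erasedGap (j + 1 + t) by
      funext t; congr 1; omega, ← ih]
    cases u[j] <;> simp

theorem reduceOption_eq_fillGaps (f : SubwordEmbedding u v) :
    v.reduceOption = fillGaps u f.erasedGap := by
  simpa [gapStart] using f.reduceOption_drop_gapStart u.length 0 (by omega)

end SubwordEmbedding

section Commute

variable {α : Type*}

/-- Words commuting with a given nonempty word are powers of a single word. -/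
theorem exists_forall_eq_wordPow_of_append_comm (x : List α) (hx : x ≠ []) :
    ∃ z : List α, ∀ y, x ++ y = y ++ x → ∃ n, y = wordPow n z := by
  classical
  have hex : ∃ n, ∃ z : List α, z ≠ [] ∧ x ++ z = z ++ x ∧ z.length = n :=
    ⟨x.length, x, hx, rfl, rfl⟩
  obtain ⟨z, hz0, hzx, hzn⟩ := Nat.find_spec hex
  have hmin : ∀ y : List α, y ≠ [] → x ++ y = y ++ x → z.length ≤ y.length := fun y hy hxy =>
    hzn ▸ Nat.find_min' hex ⟨y, hy, hxy, rfl⟩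
  have hpow : ∀ (y : List α), x ++ y = y ++ x → ∀ n, wordPow n x ++ y = y ++ wordPow n x := by
    intro y hy n
    induction n with
    | zero => simp
    | succ n ih => rw [wordPow_succ', List.append_assoc, hy, ← List.append_assoc, ih,
        List.append_assoc]
  have hpre : ∀ (y : List α), x ++ y = y ++ x → ∀ n, y.length ≤ n → y <+: wordPow n x := by
    intro y hy n hn
    refine List.prefix_of_prefix_length_le (l₃ := wordPow n x ++ y)
      ⟨wordPow n x, (hpow y hy n).symm⟩ (List.prefix_append _ _) ?_
    rw [length_wordPow]
    exact hn.trans (Nat.le_mul_of_pos_right n (List.length_pos_iff.2 hx))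
  refine ⟨z, fun y => ?_⟩
  induction hl : y.length using Nat.strong_induction_on generalizing y with
  | _ l ih =>
    intro hxy
    by_cases hy : y = []
    · exact ⟨0, hy⟩
    have hzy := hmin y hy hxy
    obtain ⟨y', rfl⟩ : z <+: y :=
      List.prefix_of_prefix_length_le (hpre z hzx y.length hzy) (hpre y hxy y.length le_rfl) hzy
    have hy' : x ++ y' = y' ++ x := by
      apply List.append_cancel_left (as := z)
      rw [← List.append_assoc, ← hzx, List.append_assoc, hxy, List.append_assoc]
    have hz := List.length_pos_iff.2 hz0
    obtain ⟨n, hn⟩ := ih y'.length (by simp at hl; omega) y' rfl hy'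
    exact ⟨n + 1, by rw [wordPow_succ, hn]⟩

theorem exists_forall_eq_wordPow_of_pairwise_comm (S : Set (List α))
    (hS : ∀ x ∈ S, ∀ y ∈ S, x ++ y = y ++ x) : ∃ z, ∀ y ∈ S, ∃ n, y = wordPow n z := by
  by_cases h : ∃ x ∈ S, x ≠ []
  · obtain ⟨x, hxS, hx⟩ := h
    obtain ⟨z, hz⟩ := exists_forall_eq_wordPow_of_append_comm x hx
    exact ⟨z, fun y hy => hz y (hS x hxS y hy)⟩
  · push Not at h
    exact ⟨[], fun y hy => ⟨0, h y hy⟩⟩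

end Commute

namespace AmalgamationSystem

variable {α : Type*} (A : AmalgamationSystem α)

/-- The families of erased gap words of the admissible embeddings of a run. -/
def gapFamilies (ρ : A.Run) : Set (ℕ → List α) :=
  {G | ∃ σ, ∃ f ∈ A.E ρ σ, G = f.erasedGap}

variable {A} {ρ : A.Run} {G H : ℕ → List α}

theorem exists_yield_eq_of_mem_gapFamilies (hG : G ∈ A.gapFamilies ρ) :
    ∃ σ, A.yield σ = fillGaps (A.can ρ) G := by
  obtain ⟨σ, f, -, rfl⟩ := hG
  exact ⟨σ, f.reduceOption_eq_fillGaps⟩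

theorem exists_bound_of_mem_gapFamilies (hG : G ∈ A.gapFamilies ρ) :
    ∃ N, ∀ j, (G j).length ≤ N := by
  obtain ⟨σ, f, -, rfl⟩ := hG
  exact ⟨_, f.length_erasedGap_le⟩

theorem exists_amalgam_mem_gapFamilies (hG : G ∈ A.gapFamilies ρ) (hH : H ∈ A.gapFamilies ρ)
    {i : ℕ} (hi : i ≤ (A.can ρ).length) :
    ∃ F ∈ A.gapFamilies ρ, (∀ j, F j = G j ++ H j ∨ F j = H j ++ G j) ∧ F i = G i ++ H i := by
  obtain ⟨σ, f, hf, rfl⟩ := hG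
  obtain ⟨τ, g, hg, rfl⟩ := hH
  have hi' : i < (A.can ρ).length + 1 := by omega
  obtain ⟨υ, g', hg', f', -, -, hj, hi''⟩ := A.amalgamation f hf g hg ⟨i, hi'⟩
  refine ⟨_, ⟨υ, g'.comp f, A.comp_mem f hf g' hg', rfl⟩, fun j => ?_, ?_⟩
  · unfold SubwordEmbedding.erasedGap
    split_ifs with h
    · rcases hj ⟨j, h⟩ with hj | hj
      · left; rw [hj, List.reduceOption_append]
      · right; rw [hj, List.reduceOption_append]
    · simp
  · simp only [SubwordEmbedding.erasedGap, dif_pos hi', hi'', List.reduceOption_append]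

theorem exists_wordPow_mem_gapFamilies (hG : G ∈ A.gapFamilies ρ) (n : ℕ) :
    (fun j => wordPow (n + 1) (G j)) ∈ A.gapFamilies ρ := by
  induction n with
  | zero => simpa [wordPow] using hG
  | succ n ih =>
    obtain ⟨F, hF, hj, -⟩ := exists_amalgam_mem_gapFamilies ih hG (Nat.zero_le _)
    convert hF using 1
    funext j
    rcases hj j with h | h
    · rw [h, wordPow_succ']
    · rw [h, wordPow_succ]

/-- Arbitrary positive powers of a concatenation can be realized in one gap, while the other gaps
contain products of the same factors. -/
theorem exists_wordPow_append_mem_gapFamilies (hG : G ∈ A.gapFamilies ρ)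
    (hH : H ∈ A.gapFamilies ρ) {i : ℕ} (hi : i ≤ (A.can ρ).length) (B : ℕ) :
    ∃ F ∈ A.gapFamilies ρ, F i = wordPow (B + 1) (G i ++ H i) ∧
      ∀ j, ∃ l : List (List α), F j = l.flatten ∧ ∀ p ∈ l, p = G j ∨ p = H j := by
  obtain ⟨K, hK, hKj, hKi⟩ := exists_amalgam_mem_gapFamilies hG hH hi
  have hK' : ∀ j, ∃ l : List (List α), K j = l.flatten ∧ ∀ p ∈ l, p = G j ∨ p = H j := by
    intro j
    rcases hKj j with h | h
    · exact ⟨[G j, H j], by simp [h], by simp⟩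
    · exact ⟨[H j, G j], by simp [h], by simp⟩
  refine ⟨_, exists_wordPow_mem_gapFamilies hK B, by simp only [hKi], fun j => ?_⟩
  obtain ⟨l, hl, hlp⟩ := hK' j
  refine ⟨(List.replicate (B + 1) l).flatten, ?_, fun p hp => ?_⟩
  · simp [wordPow, hl, List.flatten_flatten]
  · obtain ⟨l', hl', hp⟩ := List.mem_flatten.1 hp
    rw [List.eq_of_mem_replicate hl'] at hp
    exact hlp p hp

/-- A language that is well-quasi-ordered by the infix relation does not contain words `Y n` with
more mismatches than any short infix of a later one. -/
theorem not_infixWellQuasiOrdered_of_locallyPeriodic {L : Language α} {q k r : ℕ}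
    (Y : ℕ → List α) (hY : ∀ n, Y n ∈ L) (hper : ∀ n, LocallyPeriodic q n k (Y n))
    (hmis : ∀ n, r ≤ n → k + (q + 1) < shiftMismatches q (Y n)) : ¬ InfixWellQuasiOrdered L := by
  intro hL
  let a : ℕ → ℕ := fun t => (fun n => max n (Y n).length)^[t] r
  have ha : ∀ t, a (t + 1) = max (a t) (Y (a t)).length := fun t =>
    Function.iterate_succ_apply' _ _ _
  have hmono : Monotone a := monotone_nat_of_le_succ fun t => by rw [ha]; exact le_max_left _ _
  obtain ⟨s, t, hst, h⟩ := hL fun t => ⟨Y (a t), hY _⟩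
  have hlen : (Y (a s)).length ≤ a t :=
    ((le_max_right _ _).trans_eq (ha s).symm).trans (hmono hst)
  exact absurd ((hper (a t)).2 _ h hlen) (not_le.2 (hmis _ (hmono (Nat.zero_le s))))

theorem append_comm_of_mem_gapFamilies {L : Language α} (hA : A.Recognizes L)
    (hL : InfixWellQuasiOrdered L) (hG : G ∈ A.gapFamilies ρ) (hH : H ∈ A.gapFamilies ρ)
    {i : ℕ} (hi : i ≤ (A.can ρ).length) : G i ++ H i = H i ++ G i := by
  by_contra hne
  obtain ⟨U, hU, -, hUi⟩ := exists_amalgam_mem_gapFamilies hG hH hi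
  obtain ⟨V, hV, -, hVi⟩ := exists_amalgam_mem_gapFamilies hH hG hi
  obtain ⟨M, hM⟩ := exists_bound_of_mem_gapFamilies hU
  obtain ⟨N, hN⟩ := exists_bound_of_mem_gapFamilies hV
  obtain ⟨q, hq⟩ : ∃ q, (M + N).factorial = q + 1 :=
    Nat.exists_eq_succ_of_ne_zero (Nat.factorial_ne_zero _)
  have hdvd : ∀ s : List α, s.length ≤ M + N → s = [] ∨ s.length ∣ q + 1 := by
    intro s hs
    rw [or_iff_not_imp_left]
    intro h
    exact hq ▸ Nat.dvd_factorial (List.length_pos_iff.2 h) hs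
  have hdU : ∀ j, U j = [] ∨ (U j).length ∣ q + 1 := fun j => hdvd _ ((hM j).trans (by omega))
  have hdV : ∀ j, V j = [] ∨ (V j).length ∣ q + 1 := fun j => hdvd _ ((hN j).trans (by omega))
  have hlen : (U i).length = (V i).length := by simp [hUi, hVi, add_comm]
  have hneUV : U i ≠ V i := by rwa [hUi, hVi]
  have hdi : (U i).length ∣ q + 1 := by
    rcases hdU i with h | h
    · refine absurd ?_ hneUV
      rw [h] at hlen ⊢
      exact (List.length_eq_zero_iff.1 hlen.symm).symm
    · exact h
  have key : ∀ n, ∃ y ∈ L, LocallyPeriodic q n (A.can ρ).length y ∧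
      (q + 1 ≤ n → (A.can ρ).length + (q + 1) < shiftMismatches q y) := by
    intro n
    cases n with
    | zero =>
      obtain ⟨σ, hσ⟩ := exists_yield_eq_of_mem_gapFamilies hG
      refine ⟨A.yield σ, hA ▸ ⟨σ, rfl⟩, ⟨fun x _ hx => ?_, fun x _ hx => ?_⟩, by simp⟩ <;>
      · obtain rfl := List.length_eq_zero_iff.1 (Nat.le_zero.1 hx)
        simp [shiftMismatches]
    | succ n =>
      obtain ⟨F, hF, hFi, hFj⟩ := exists_wordPow_append_mem_gapFamilies
        (exists_wordPow_mem_gapFamilies hU n) (exists_wordPow_mem_gapFamilies hV n) hi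
        ((A.can ρ).length + (q + 1))
      obtain ⟨σ, hσ⟩ := exists_yield_eq_of_mem_gapFamilies hF
      refine ⟨fillGaps (A.can ρ) F, hA ▸ ⟨σ, hσ⟩, locallyPeriodic_fillGaps _ _ fun j => ?_,
        fun hn => ?_⟩
      · obtain ⟨l, hl, hp⟩ := hFj j
        refine ⟨l, hl, fun p hpl => ?_⟩
        rcases hp p hpl with rfl | rfl
        · exact ⟨_, rfl, hdU j⟩
        · exact ⟨_, rfl, hdV j⟩
      · refine lt_of_lt_of_le ?_ (shiftMismatches_mono (infix_fillGaps _ F i hi))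
        rw [hFi]
        exact le_shiftMismatches_wordPow _ _
          (one_le_shiftMismatches_wordPow_append hlen hneUV hdi hn)
  choose Y hY hper hmis using key
  exact not_infixWellQuasiOrdered_of_locallyPeriodic Y hY hper hmis hL

variable (A) in
theorem exists_finset_forall_exists_nonempty_E :
    ∃ S : Finset A.Run, ∀ σ, ∃ ρ ∈ S, (A.E ρ σ).Nonempty := by
  by_contra! h
  obtain ⟨f, -, hf⟩ := exists_seq_of_forall_finset_exists (fun _ : A.Run => True)
    (fun ρ σ => A.E ρ σ = ∅) fun S _ => (h S).imp fun σ hσ => ⟨trivial, hσ⟩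
  obtain ⟨m, n, hmn, hne⟩ := A.wqo f
  exact hne.ne_empty (hf m n hmn)

end AmalgamationSystem

/-- Finitely many bounded languages are contained in a common one. -/
theorem exists_forall_mem_le_prod_kstar {α ι : Type*} (S : Finset ι) (ws : ι → List (List α)) :
    ∃ ws' : List (List α), ∀ i ∈ S, ((ws i).map fun w => KStar.kstar ({w} : Language α)).prod ≤
      (ws'.map fun w => KStar.kstar ({w} : Language α)).prod := by
  classical
  have hone : ∀ l : List (List α), 1 ≤ (l.map fun w => KStar.kstar ({w} : Language α)).prod := by
    intro l
    induction l with
    | nil => simp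
    | cons w l ih =>
      rw [List.map_cons, List.prod_cons, ← one_mul (1 : Language α)]
      exact mul_le_mul' one_le_kstar ih
  induction S using Finset.induction_on with
  | empty => exact ⟨[], by simp⟩
  | insert i S _ ih =>
    obtain ⟨ws', h⟩ := ih
    refine ⟨ws i ++ ws', fun j hj => ?_⟩
    rw [List.map_append, List.prod_append]
    rcases Finset.mem_insert.1 hj with rfl | hj
    · exact le_mul_of_one_le_right' (hone _)
    · exact (h j hj).trans (le_mul_of_one_le_left' (hone _))

theorem mainTheorem3 {α : Type*} [Finite α] (L : Language α) (A : AmalgamationSystem α)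
    (hA : A.Recognizes L) (hL : InfixWellQuasiOrdered L) : IsBoundedLanguage L := by
  have key : ∀ ρ : A.Run, ∃ ws : List (List α), ∀ G ∈ A.gapFamilies ρ,
      fillGaps (A.can ρ) G ∈ (ws.map fun w => KStar.kstar ({w} : Language α)).prod := by
    intro ρ
    have hW : ∀ i, ∃ z, i ≤ (A.can ρ).length → ∀ G ∈ A.gapFamilies ρ, ∃ n, G i = wordPow n z := by
      intro i
      by_cases hi : i ≤ (A.can ρ).length
      · obtain ⟨z, hz⟩ := exists_forall_eq_wordPow_of_pairwise_comm
          ((fun G => G i) '' A.gapFamilies ρ) (by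
            rintro _ ⟨G, hG, rfl⟩ _ ⟨H, hH, rfl⟩
            exact AmalgamationSystem.append_comm_of_mem_gapFamilies hA hL hG hH hi)
        exact ⟨z, fun _ G hG => hz _ ⟨G, hG, rfl⟩⟩
      · exact ⟨[], fun h => absurd h hi⟩
    choose W hW using hW
    obtain ⟨ws, hws⟩ := fillGaps_mem_prod (A.can ρ) W
    exact ⟨ws, fun G hG => hws G fun j hj => hW j hj G hG⟩
  choose ws hws using key
  obtain ⟨S, hS⟩ := A.exists_finset_forall_exists_nonempty_E
  obtain ⟨ws', hws'⟩ := exists_forall_mem_le_prod_kstar S ws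
  refine ⟨ws', fun x hx => ?_⟩
  rw [hA] at hx
  obtain ⟨σ, rfl⟩ := hx
  obtain ⟨ρ, hρ, f, hf⟩ := hS σ
  apply hws' ρ hρ
  rw [AmalgamationSystem.yield, f.reduceOption_eq_fillGaps]
  exact hws ρ _ ⟨σ, f, hf, rfl⟩
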